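/- Let $p$ be a prime and $n\in\mathbb N$. For $x=(x_1,\dots,x_n)\in\mathbb Q_p^n$ let $\|x\|_p=\max_{1\le i\le n}|x_i|_p$, and let $\mathcal S_n=\{x\in\mathbb Q_p^n : \|x\|_p=1\}$ be the $p$-adic unit sphere with the subspace topology. The group $GL(n,\mathbb Q_p)$ acts on $\mathcal S_n$ by $\overline T(x)=\|T(x)\|_p\,T(x)$, where the rational number $\|T(x)\|_p$ (a power of $p$) is regarded as a scalar in $\mathbb Q_p$. A subset $A\subset GL(n,\mathbb Q_p)$ is said to act distally on $\mathcal S_n$ if for all $x\neq y$ in $\mathcal S_n$ the closure of $\{(\overline T(x),\overline T(y)) : T\in A\}$ in $\mathcal S_n\times\mathcal S_n$ does not meet the diagonal. Let $\mathcal D$ be the centre of $GL(n,\mathbb Q_p)$ and let $PGL(n,\mathbb Q_p)=GL(n,\mathbb Q_p)/\mathcal D$ carry the quotient topology. Let $\mathfrak S\subset GL(n,\mathbb Q_p)$ be a non-empty semigroup, i.e. a non-empty subset closed under multiplication. Then the following are equivalent: (i) $\mathfrak S$ acts distally on $\mathcal S_n$; (ii) the subgroup of $GL(n,\mathbb Q_p)$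 generated by $\mathfrak S$ acts distally on $\mathcal S_n$; (iii) the closure of $(\mathfrak S\mathcal D)/\mathcal D$ in $PGL(n,\mathbb Q_p)$ is a compact group, i.e. it is compact and is a subgroup of $PGL(n,\mathbb Q_p)$. -/

import Mathlib

open scoped MatrixGroups

/-- The semigroup (or just set) `S` of transformations acts distally on `X`: for distinct `x`, `y`,
the closure of `{(T x, T y) | T ∈ S}` in `X × X` does not meet the diagonal. -/
def ActsDistally {G : Type*} (X : Type*) [TopologicalSpace X] [SMul G X] (S : Set G) : Prop :=
  ∀ x y : X, x ≠ y → Disjoint (closure {q : X × X | ∃ T ∈ S, q = (T • x, T • y)}) (Set.diagonal X)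

/-- `PGL(n, R)` carries the quotient topology from `GL(n, R)`. -/
instance Matrix.ProjGenLinGroup.instTopologicalSpaceQuotient {ι : Type*} [Fintype ι]
    [DecidableEq ι] {R : Type*} [CommRing R] [TopologicalSpace R] :
    TopologicalSpace (Matrix.ProjGenLinGroup ι R) :=
  inferInstanceAs (TopologicalSpace (GL ι R ⧸ Subgroup.center (GL ι R)))

namespace PadicSphere

variable {p : ℕ} [Fact p.Prime] {n : ℕ}

/-- The `p`-adic norm `max_i |v_i|_p` of a vector, as a rational number. -/
noncomputable def vecNorm (v : Fin n → ℚ_[p]) : ℚ :=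
  ((Finset.univ.sup fun i => (padicNormE (v i)).toNNRat : ℚ≥0) : ℚ)

/-- The rational norm agrees with Mathlib's (supremum) norm on `Fin n → ℚ_[p]`. -/
theorem cast_vecNorm (v : Fin n → ℚ_[p]) : ((vecNorm v : ℚ) : ℝ) = ‖v‖ := by
  have hle : ∀ i, padicNormE (v i) ≤ vecNorm v := fun i => by
    have := Finset.le_sup (f := fun i => (padicNormE (v i)).toNNRat) (Finset.mem_univ i)
    exact Rat.toNNRat_le_iff_le_coe.1 this
  apply le_antisymm
  · rcases isEmpty_or_nonempty (Fin n) with h | h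
    · rw [vecNorm, Finset.univ_eq_empty, Finset.sup_empty]; simp
    · obtain ⟨i, -, hi⟩ := Finset.exists_mem_eq_sup Finset.univ Finset.univ_nonempty
        (fun i => (padicNormE (v i)).toNNRat)
      have : vecNorm v = padicNormE (v i) := by
        rw [vecNorm, hi, Rat.coe_toNNRat _ (padicNormE.nonneg _)]
      rw [this]
      exact norm_le_pi_norm v i
  · refine (pi_norm_le_iff_of_nonneg ?_).2 fun i => ?_
    · exact_mod_cast NNRat.coe_nonneg _
    · change ((padicNormE (v i) : ℚ) : ℝ) ≤ _
      exact_mod_cast hle i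

theorem vecNorm_smul (a : ℚ_[p]) (v : Fin n → ℚ_[p]) :
    vecNorm (a • v) = padicNormE a * vecNorm v := by
  have h : ((vecNorm (a • v) : ℚ) : ℝ) = ((padicNormE a * vecNorm v : ℚ) : ℝ) := by
    rw [Rat.cast_mul, cast_vecNorm, cast_vecNorm, norm_smul]
    rfl
  exact_mod_cast h

theorem exists_vecNorm_eq_zpow {v : Fin n → ℚ_[p]} (hv : v ≠ 0) :
    ∃ k : ℤ, vecNorm v = (p : ℚ) ^ k := by
  have hne : (Finset.univ : Finset (Fin n)).Nonempty := by
    obtain ⟨i, -⟩ := Function.ne_iff.1 hv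
    exact ⟨i, Finset.mem_univ i⟩
  obtain ⟨i, -, hi⟩ := Finset.exists_mem_eq_sup Finset.univ hne
    (fun i => (padicNormE (v i)).toNNRat)
  have h : vecNorm v = padicNormE (v i) := by
    rw [vecNorm, hi, Rat.coe_toNNRat _ (padicNormE.nonneg _)]
  have hvi : v i ≠ 0 := by
    intro h0
    rw [h0, map_zero] at h
    apply hv
    rw [← norm_eq_zero, ← cast_vecNorm, h, Rat.cast_zero]
  obtain ⟨k, hk⟩ := padicNormE.image' hvi
  exact ⟨-k, by rw [h, hk]⟩

theorem padicNormE_vecNorm_mul {v : Fin n → ℚ_[p]} (hv : v ≠ 0) :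
    padicNormE ((vecNorm v : ℚ) : ℚ_[p]) * vecNorm v = 1 := by
  obtain ⟨k, hk⟩ := exists_vecNorm_eq_zpow hv
  have hp : (p : ℚ) ≠ 0 := by exact_mod_cast (Fact.out : p.Prime).ne_zero
  have hn : ((padicNormE ((vecNorm v : ℚ) : ℚ_[p]) : ℚ) : ℝ) = (((p : ℚ) ^ (-k) : ℚ) : ℝ) := by
    change ‖((vecNorm v : ℚ) : ℚ_[p])‖ = _
    rw [hk]
    push_cast
    exact Padic.norm_p_zpow k
  have hn' : padicNormE ((vecNorm v : ℚ) : ℚ_[p]) = (p : ℚ) ^ (-k) := Rat.cast_injective hn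
  rw [hn', hk, ← zpow_add₀ hp, neg_add_cancel, zpow_zero]

variable (p n) in
/-- The `p`-adic unit sphere in `ℚ_p ^ n`, with the subspace topology. -/
abbrev UnitSphere : Type := Metric.sphere (0 : Fin n → ℚ_[p]) 1

theorem norm_coe (x : UnitSphere p n) : ‖(x : Fin n → ℚ_[p])‖ = 1 := by simp

theorem mulVec_ne_zero (T : GL (Fin n) ℚ_[p]) {v : Fin n → ℚ_[p]} (hv : v ≠ 0) :
    (T : Matrix (Fin n) (Fin n) ℚ_[p]).mulVec v ≠ 0 := by
  intro h
  apply hv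
  have h2 := congrArg (((T⁻¹ : GL (Fin n) ℚ_[p]) : Matrix (Fin n) (Fin n) ℚ_[p]).mulVec) h
  rwa [Matrix.mulVec_mulVec, ← Units.val_mul, inv_mul_cancel, Units.val_one, Matrix.one_mulVec,
    Matrix.mulVec_zero] at h2

theorem coe_ne_zero (x : UnitSphere p n) : (x : Fin n → ℚ_[p]) ≠ 0 := by
  intro h
  have := norm_coe x
  simp [h] at this

/-- `T` sends `x` to `‖T x‖_p • T x`. -/
noncomputable instance : SMul (GL (Fin n) ℚ_[p]) (UnitSphere p n) where
  smul T x :=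
    ⟨((vecNorm ((T : Matrix (Fin n) (Fin n) ℚ_[p]).mulVec x) : ℚ) : ℚ_[p]) •
      (T : Matrix (Fin n) (Fin n) ℚ_[p]).mulVec x, by
      rw [mem_sphere_zero_iff_norm, ← cast_vecNorm, vecNorm_smul,
        padicNormE_vecNorm_mul (mulVec_ne_zero T (coe_ne_zero x)), Rat.cast_one]⟩

theorem coe_smul (T : GL (Fin n) ℚ_[p]) (x : UnitSphere p n) :
    ((T • x : UnitSphere p n) : Fin n → ℚ_[p]) =
      ((vecNorm ((T : Matrix (Fin n) (Fin n) ℚ_[p]).mulVec x) : ℚ) : ℚ_[p]) •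
        (T : Matrix (Fin n) (Fin n) ℚ_[p]).mulVec x := rfl

noncomputable instance : MulAction (GL (Fin n) ℚ_[p]) (UnitSphere p n) where
  one_smul x := by
    have h : vecNorm (x : Fin n → ℚ_[p]) = 1 := by
      have := cast_vecNorm (x : Fin n → ℚ_[p])
      rw [norm_coe] at this
      exact_mod_cast this
    apply Subtype.ext
    rw [coe_smul, Units.val_one, Matrix.one_mulVec, h, Rat.cast_one, one_smul]
  mul_smul S T x := by
    apply Subtype.ext
    have hT := mulVec_ne_zero T (coe_ne_zero x)
    rw [coe_smul, coe_smul S, coe_smul T, Matrix.mulVec_smul, vecNorm_smul, Units.val_mul,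
      ← Matrix.mulVec_mulVec, smul_smul, ← Rat.cast_mul, mul_right_comm, padicNormE_vecNorm_mul hT,
      one_mul]

end PadicSphere

/-!
A distal set of transformations of a compact metric space is one that keeps each pair of distinct
points a positive distance apart, uniformly over the set (`actsDistally_iff_exists_le_dist`). On the
`p`-adic sphere, scalars act by multiplication by units, hence by isometries, so for fixed `x` and
`y` the distance `dist (T • x) (T • y)` depends only on the class of `T` in `PGL`, and continuously
so. Therefore any subset of `GL` whose image in `PGL` lies in a compact set is distal
(`PadicSphere.actsDistally_of_mk_mem_isCompact`).

Conversely, let `S` be distal and rescale each element of `S` so that its entries lie in `ℤ_p` and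
one of them equals `1`. The rescaled matrices form a relatively compact set of matrices. None of
their limits `A` is singular: otherwise a small `v ≠ 0` with `A v = 0`, together with a unit vector
`x` with `A x ≠ 0`, gives points `x` and `x + v` of the sphere which `S` brings arbitrarily close
(`PadicSphere.det_ne_zero_of_mem_closure`). So their closure is a compact subset of `GL`, whose
image in `PGL` contains that of `S` (`PadicSphere.isCompact_closure_mk_image`).

When `S` is a semigroup, the closure of its image in `PGL` is then a compact semigroup in a
Hausdorff group, hence a group (`Subsemigroup.inv_mem_of_isCompact`). Being a group, it also
contains the image of the group generated by `S`, and that group is distal in turn.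
-/

open PadicSphere Matrix Topology

/-! ### Distal subsets and compact subsemigroups -/

theorem ActsDistally.mono {G X : Type*} [TopologicalSpace X] [SMul G X] {S T : Set G}
    (hST : S ⊆ T) (hT : ActsDistally X T) : ActsDistally X S := fun x y hxy =>
  (hT x y hxy).mono_left <| closure_mono <| by
    rintro _ ⟨g, hg, rfl⟩
    exact ⟨g, hST hg, rfl⟩

theorem actsDistally_iff_exists_le_dist {G X : Type*} [MetricSpace X] [CompactSpace X]
    [SMul G X] {S : Set G} :
    ActsDistally X S ↔ ∀ x y : X, x ≠ y → ∃ ε > 0, ∀ g ∈ S, ε ≤ dist (g • x) (g • y) := by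
  refine forall₃_congr fun x y _ => ⟨fun h => ?_, ?_⟩
  · set Z := closure {q : X × X | ∃ g ∈ S, q = (g • x, g • y)}
    have hmem : ∀ g ∈ S, (g • x, g • y) ∈ Z := fun g hg => subset_closure ⟨g, hg, rfl⟩
    rcases Z.eq_empty_or_nonempty with h0 | hne
    · exact ⟨1, one_pos, fun g hg => by simpa [h0] using hmem g hg⟩
    · obtain ⟨q, hq, hmin⟩ := isClosed_closure.isCompact.exists_isMinOn hne
        (f := fun q : X × X => dist q.1 q.2) (by fun_prop)
      refine ⟨dist q.1 q.2, dist_pos.2 fun he => ?_, fun g hg => hmin (hmem g hg)⟩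
      exact Set.disjoint_left.1 h hq he
  · rintro ⟨ε, hε, h⟩
    have hsub : closure {q : X × X | ∃ g ∈ S, q = (g • x, g • y)} ⊆ {q | ε ≤ dist q.1 q.2} := by
      refine closure_minimal ?_ (isClosed_le continuous_const (by fun_prop))
      rintro _ ⟨g, hg, rfl⟩
      exact h g hg
    refine Set.disjoint_left.2 fun q hq hd => ?_
    have h1 : ε ≤ dist q.1 q.2 := hsub hq
    rw [Set.mem_diagonal_iff.1 hd, dist_self] at h1
    exact absurd hε h1.not_gt

/-- A compact subsemigroup of a Hausdorff topological group is closed under inversion: for `a` in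
it, `a * K` is again a compact semigroup, so it contains an idempotent, which can only be `1`. -/
theorem Subsemigroup.inv_mem_of_isCompact {G : Type*} [Group G] [TopologicalSpace G]
    [IsTopologicalGroup G] [T2Space G] (K : Subsemigroup G) (hK : IsCompact (K : Set G)) {a : G}
    (ha : a ∈ K) : a⁻¹ ∈ K := by
  obtain ⟨_, ⟨k, hk, rfl⟩, hm⟩ := exists_idempotent_in_compact_subsemigroup
    (fun r : G => continuous_mul_const r) ((fun k => a * k) '' (K : Set G))
    ⟨_, a, ha, rfl⟩ (hK.image (continuous_const_mul a)) (by
      rintro _ ⟨x, hx, rfl⟩ _ ⟨y, hy, rfl⟩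
      exact ⟨x * (a * y), K.mul_mem hx (K.mul_mem ha hy), by simp only [mul_assoc]⟩)
  have h1 : a * k = 1 := mul_eq_left.1 hm
  rwa [inv_eq_of_mul_eq_one_right h1]

namespace Matrix.ProjGenLinGroup

/-! ### The topology of the projective linear group -/

variable {ι R : Type*} [Fintype ι] [DecidableEq ι] [CommRing R] [TopologicalSpace R]

theorem isQuotientMap_mk : IsQuotientMap (mk : GL ι R → ProjGenLinGroup ι R) :=
  QuotientGroup.isQuotientMap_mk (Subgroup.center (GL ι R))

variable [IsTopologicalRing R]

instance : IsTopologicalGroup (ProjGenLinGroup ι R) :=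
  inferInstanceAs (IsTopologicalGroup (GL ι R ⧸ Subgroup.center (GL ι R)))

instance [T2Space R] : T2Space (ProjGenLinGroup ι R) := by
  have : T2Space (Matrix ι ι R) := inferInstanceAs (T2Space (ι → ι → R))
  have : T2Space (GL ι R) := Units.isEmbedding_embedProduct.t2Space
  have : IsClosed (Subgroup.center (GL ι R) : Set (GL ι R)) := by
    rw [Subgroup.coe_center, ← Set.centralizer_univ]
    exact Set.isClosed_centralizer _
  exact inferInstanceAs (T2Space (GL ι R ⧸ Subgroup.center (GL ι R)))

end Matrix.ProjGenLinGroup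

namespace PadicSphere

variable {p : ℕ} [Fact p.Prime] {n : ℕ}

/-! ### Normalization of vectors -/

/-- The vector `‖v‖_p • v`, which has norm `1` when `v ≠ 0`. -/
noncomputable def normalize (v : Fin n → ℚ_[p]) : Fin n → ℚ_[p] :=
  ((vecNorm v : ℚ) : ℚ_[p]) • v

theorem dist_smul (T : GL (Fin n) ℚ_[p]) (x y : UnitSphere p n) :
    dist (T • x) (T • y) =
      dist (normalize ((T : Matrix (Fin n) (Fin n) ℚ_[p]) *ᵥ x))
        (normalize ((T : Matrix (Fin n) (Fin n) ℚ_[p]) *ᵥ y)) := rfl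

/-- The rational norm is locally constant away from `0`, by the ultrametric inequality. -/
theorem continuousAt_normalize {v : Fin n → ℚ_[p]} (hv : v ≠ 0) : ContinuousAt normalize v := by
  have hloc : (fun w : Fin n → ℚ_[p] => ((vecNorm v : ℚ) : ℚ_[p]) • w) =ᶠ[𝓝 v] normalize := by
    filter_upwards [Metric.ball_mem_nhds v (norm_pos_iff.2 hv)] with w hw
    have hn : ‖w‖ = ‖v‖ := by
      rw [mem_ball_iff_norm] at hw
      have h1 := IsUltrametricDist.norm_add_eq_max_of_norm_ne_norm hw.ne
      rwa [sub_add_cancel, max_eq_right hw.le] at h1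
    have : vecNorm w = vecNorm v := by
      rw [← cast_vecNorm, ← cast_vecNorm] at hn
      exact_mod_cast hn
    rw [normalize, this]
  exact (continuous_const_smul _).continuousAt.congr hloc

theorem norm_padicNormE_mul_self {c : ℚ_[p]} (hc : c ≠ 0) :
    ‖((padicNormE c : ℚ) : ℚ_[p]) * c‖ = 1 := by
  obtain ⟨k, hk⟩ := padicNormE.image' hc
  have hp : (p : ℝ) ≠ 0 := by exact_mod_cast (Fact.out : p.Prime).ne_zero
  have h1 : ‖c‖ = (p : ℝ) ^ (-k) := by
    change ((padicNormE c : ℚ) : ℝ) = _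
    rw [hk]
    push_cast
    rfl
  rw [norm_mul, h1, hk]
  push_cast
  rw [Padic.norm_p_zpow, ← zpow_add₀ hp]
  simp

theorem dist_normalize_smul {c : ℚ_[p]} (hc : c ≠ 0) (v w : Fin n → ℚ_[p]) :
    dist (normalize (c • v)) (normalize (c • w)) = dist (normalize v) (normalize w) := by
  have h : ∀ u : Fin n → ℚ_[p],
      normalize (c • u) = (((padicNormE c : ℚ) : ℚ_[p]) * c) • normalize u := fun u => by
    rw [normalize, normalize, vecNorm_smul, smul_smul, smul_smul, Rat.cast_mul]
    ring_nf
  rw [h, h, dist_smul₀, norm_padicNormE_mul_self hc, one_mul]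

theorem continuous_dist_smul (x y : UnitSphere p n) :
    Continuous fun T : GL (Fin n) ℚ_[p] => dist (T • x) (T • y) := by
  have h : ∀ z : UnitSphere p n, Continuous fun T : GL (Fin n) ℚ_[p] =>
      normalize ((T : Matrix (Fin n) (Fin n) ℚ_[p]) *ᵥ z) := fun z =>
    continuous_iff_continuousAt.2 fun T =>
      ContinuousAt.comp (f := fun T : GL (Fin n) ℚ_[p] => (T : Matrix (Fin n) (Fin n) ℚ_[p]) *ᵥ z)
        (continuousAt_normalize (mulVec_ne_zero T (coe_ne_zero z)))
        (Units.continuous_val.matrix_mulVec continuous_const).continuousAt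
  simpa only [dist_smul] using (h x).dist (h y)

/-! ### From compactness to distality -/

theorem actsDistally_of_mk_mem_isCompact {S : Set (GL (Fin n) ℚ_[p])}
    {K : Set (ProjGenLinGroup (Fin n) ℚ_[p])} (hK : IsCompact K)
    (hS : ∀ T ∈ S, ProjGenLinGroup.mk T ∈ K) : ActsDistally (UnitSphere p n) S := by
  refine actsDistally_iff_exists_le_dist.2 fun x y hxy => ?_
  rcases K.eq_empty_or_nonempty with rfl | hne
  · exact ⟨1, one_pos, fun T hT => absurd (hS T hT) (Set.notMem_empty _)⟩
  -- `T ↦ dist (T • x) (T • y)` descends to the projective group, since scalars act by units.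
  set f : ProjGenLinGroup (Fin n) ℚ_[p] → ℝ := fun q =>
    dist (Function.surjInv ProjGenLinGroup.mk_surjective q • x)
      (Function.surjInv ProjGenLinGroup.mk_surjective q • y)
  have hf : ∀ T, f (ProjGenLinGroup.mk T) = dist (T • x) (T • y) := fun T => by
    obtain ⟨u, hu⟩ := ProjGenLinGroup.mk_eq_mk_iff.1
      (Function.surjInv_eq ProjGenLinGroup.mk_surjective (ProjGenLinGroup.mk T)).symm
    simp only [f]
    rw [← hu, dist_smul, dist_smul, ← GeneralLinearGroup.scalar_commute]
    simp only [Units.val_mul, GeneralLinearGroup.coe_scalar, scalar_apply,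
      ← smul_one_eq_diagonal, smul_mul, one_mul, smul_mulVec]
    exact dist_normalize_smul u.ne_zero _ _
  have hcont : Continuous f := by
    rw [ProjGenLinGroup.isQuotientMap_mk.continuous_iff]
    exact (continuous_dist_smul x y).congr fun T => (hf T).symm
  obtain ⟨q, -, hq⟩ := hK.exists_isMinOn hne hcont.continuousOn
  refine ⟨f q, ?_, fun T hT => hf T ▸ hq (hS T hT)⟩
  obtain ⟨T, rfl⟩ := ProjGenLinGroup.mk_surjective q
  rw [hf]
  exact dist_pos.2 ((MulAction.injective T).ne hxy)

/-! ### From distality to compactness -/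

/-- The matrices with entries in `ℤ_p` and at least one entry equal to `1`. Every non-zero matrix
is a scalar multiple of one of these, namely its quotient by an entry of largest norm. -/
def normalizedMatrices (p : ℕ) [Fact p.Prime] (n : ℕ) : Set (Matrix (Fin n) (Fin n) ℚ_[p]) :=
  {A | (∀ i j, ‖A i j‖ ≤ 1) ∧ ∃ i j, A i j = 1}

theorem isCompact_normalizedMatrices : IsCompact (normalizedMatrices p n) := by
  have h1 : IsCompact
      {A : Matrix (Fin n) (Fin n) ℚ_[p] | ∀ i j, A i j ∈ Metric.closedBall 0 1} := by
    have h : IsCompact (Set.univ.pi fun _ : Fin n => Set.univ.pi fun _ : Fin n =>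
        Metric.closedBall (0 : ℚ_[p]) 1) :=
      isCompact_univ_pi fun _ => isCompact_univ_pi fun _ => isCompact_closedBall 0 1
    simpa only [Set.pi, Set.mem_univ, true_imp_iff] using! h
  have h2 : IsClosed {A : Matrix (Fin n) (Fin n) ℚ_[p] | ∃ i j, A i j = 1} := by
    simp only [Set.ofPred_exists]
    exact isClosed_iUnion_of_finite fun i => isClosed_iUnion_of_finite fun j =>
      isClosed_eq (continuous_id.matrix_elem i j) continuous_const
  convert h1.inter_right h2 using 1
  ext A
  simp [normalizedMatrices]

theorem exists_smul_mem_normalizedMatrices {A : Matrix (Fin n) (Fin n) ℚ_[p]} (hA : A ≠ 0) :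
    ∃ c : ℚ_[p], c ≠ 0 ∧ c • A ∈ normalizedMatrices p n := by
  obtain ⟨i₀, j₀, h0⟩ : ∃ i j, A i j ≠ 0 := by
    by_contra! h
    exact hA (Matrix.ext h)
  obtain ⟨⟨i, j⟩, -, hmax⟩ := Finset.exists_max_image Finset.univ
    (fun ij : Fin n × Fin n => ‖A ij.1 ij.2‖) ⟨(i₀, j₀), Finset.mem_univ _⟩
  have hpos : 0 < ‖A i j‖ :=
    (norm_pos_iff.2 h0).trans_le (hmax (i₀, j₀) (Finset.mem_univ _))
  have hne : A i j ≠ 0 := norm_pos_iff.1 hpos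
  refine ⟨(A i j)⁻¹, inv_ne_zero hne, fun k l => ?_, i, j, ?_⟩
  · rw [Matrix.smul_apply, smul_eq_mul, norm_mul, norm_inv, inv_mul_le_one₀ hpos]
    exact hmax (k, l) (Finset.mem_univ _)
  · rw [Matrix.smul_apply, smul_eq_mul, inv_mul_cancel₀ hne]

/-- A singular limit `A ≠ 0` of scalar multiples of elements of a distal set is impossible: if
`A x ≠ 0` and `A v = 0` with `‖v‖ < ‖x‖ = 1`, then `x` and `x + v` are distinct points of the sphere
that the set brings arbitrarily close. -/
theorem det_ne_zero_of_mem_closure {S : Set (GL (Fin n) ℚ_[p])}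
    (hS : ActsDistally (UnitSphere p n) S) {A : Matrix (Fin n) (Fin n) ℚ_[p]} (hA : A ≠ 0)
    (hcl : A ∈ closure {B : Matrix (Fin n) (Fin n) ℚ_[p] |
      ∃ T ∈ S, ∃ c : ℚ_[p], c ≠ 0 ∧ B = c • (T : Matrix (Fin n) (Fin n) ℚ_[p])}) :
    A.det ≠ 0 := by
  intro hdet
  obtain ⟨v₀, hv₀, hAv₀⟩ := Matrix.exists_mulVec_eq_zero_iff.2 hdet
  obtain ⟨i, j, hij⟩ : ∃ i j, A i j ≠ 0 := by
    by_contra! h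
    exact hA (Matrix.ext h)
  obtain ⟨a, ha0, ha⟩ := NormedField.exists_norm_lt ℚ_[p] (inv_pos.2 (norm_pos_iff.2 hv₀))
  set v := a • v₀ with hv
  have hv0 : v ≠ 0 := smul_ne_zero (norm_pos_iff.1 ha0) hv₀
  have hv1 : ‖v‖ < 1 := by
    rw [hv, norm_smul]
    exact (lt_inv_mul_iff₀' (norm_pos_iff.2 hv₀)).1 (by simpa using ha)
  have hAv : A *ᵥ v = 0 := by rw [hv, mulVec_smul, hAv₀, smul_zero]
  set x : Fin n → ℚ_[p] := Pi.single j 1 with hx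
  have hx1 : ‖x‖ = 1 := by rw [hx, Pi.norm_single, norm_one]
  have hy1 : ‖x + v‖ = 1 := by
    rw [IsUltrametricDist.norm_add_eq_max_of_norm_ne_norm (by rw [hx1]; exact hv1.ne'), hx1,
      max_eq_left hv1.le]
  have hAx : A *ᵥ x ≠ 0 := fun h => hij (by simpa [hx] using congrFun h i)
  have hAy : A *ᵥ (x + v) = A *ᵥ x := by rw [mulVec_add, hAv, add_zero]
  obtain ⟨ε, hε, hdist⟩ := actsDistally_iff_exists_le_dist.1 hS
    ⟨x, mem_sphere_zero_iff_norm.2 hx1⟩ ⟨x + v, mem_sphere_zero_iff_norm.2 hy1⟩ (by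
      simpa [Subtype.ext_iff] using hv0)
  have hcont : ∀ w, A *ᵥ w ≠ 0 → ContinuousAt
      (fun B : Matrix (Fin n) (Fin n) ℚ_[p] => normalize (B *ᵥ w)) A := fun w hw =>
    ContinuousAt.comp (f := fun B : Matrix (Fin n) (Fin n) ℚ_[p] => B *ᵥ w)
      (continuousAt_normalize hw) (continuous_id.matrix_mulVec continuous_const).continuousAt
  have hlim := (hcont x hAx).dist (hcont (x + v) (by rwa [hAy]))
  have hsmall := hlim.eventually_lt_const (u := ε) (by
    simpa only [hAy, dist_self] using hε)
  obtain ⟨_, hlt, T, hT, c, hc, rfl⟩ := mem_closure_iff_nhds.1 hcl _ hsmall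
  have hlt' : dist (normalize ((c • (T : Matrix (Fin n) (Fin n) ℚ_[p])) *ᵥ x))
    (normalize ((c • (T : Matrix (Fin n) (Fin n) ℚ_[p])) *ᵥ (x + v))) < ε := hlt
  rw [smul_mulVec, smul_mulVec, dist_normalize_smul hc] at hlt'
  exact (hdist T hT).not_gt hlt'

theorem isCompact_closure_mk_image {S : Set (GL (Fin n) ℚ_[p])}
    (hS : ActsDistally (UnitSphere p n) S) :
    IsCompact (closure (ProjGenLinGroup.mk '' S : Set (ProjGenLinGroup (Fin n) ℚ_[p]))) := by
  -- For `n = 0` the zero matrix is invertible and cannot be normalized.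
  rcases isEmpty_or_nonempty (Fin n) with hn | hn
  · have : Finite (ProjGenLinGroup (Fin n) ℚ_[p]) :=
      Finite.of_surjective _ ProjGenLinGroup.mk_surjective
    exact (Set.toFinite _).isCompact
  set M := {B : Matrix (Fin n) (Fin n) ℚ_[p] |
    ∃ T ∈ S, ∃ c : ℚ_[p], c ≠ 0 ∧ B = c • (T : Matrix (Fin n) (Fin n) ℚ_[p])}
  set F := normalizedMatrices p n ∩ closure M
  have hFc : IsCompact F := isCompact_normalizedMatrices.inter_right isClosed_closure
  have hdet : ∀ A : F, (A : Matrix (Fin n) (Fin n) ℚ_[p]).det ≠ 0 := fun A => by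
    refine det_ne_zero_of_mem_closure hS ?_ A.2.2
    obtain ⟨-, i, j, h⟩ := A.2.1
    intro h0
    simp [h0] at h
  have : CompactSpace F := isCompact_iff_compactSpace.1 hFc
  set g : F → GL (Fin n) ℚ_[p] := fun A => GeneralLinearGroup.mkOfDetNeZero A.1 (hdet A) with hg
  have hgc : Continuous g := by
    refine Units.continuous_iff.2 ⟨continuous_subtype_val, ?_⟩
    have : (fun A : F => ((g A)⁻¹ : GL (Fin n) ℚ_[p]).val) =
        fun A : F => (A.1.det)⁻¹ • A.1.adjugate := by
      ext1 A
      rw [GeneralLinearGroup.coe_inv, Matrix.inv_def, Ring.inverse_eq_inv']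
      rfl
    rw [this]
    exact (continuous_subtype_val.matrix_det.inv₀ hdet).smul
      continuous_subtype_val.matrix_adjugate
  refine (isCompact_range
    (ProjGenLinGroup.isQuotientMap_mk.continuous.comp hgc)).closure_of_subset ?_
  rintro _ ⟨T, hT, rfl⟩
  obtain ⟨c, hc, hcT⟩ := exists_smul_mem_normalizedMatrices (p := p) T.ne_zero
  refine ⟨⟨c • T.1, hcT, subset_closure ⟨T, hT, c, hc, rfl⟩⟩, ?_⟩
  refine (ProjGenLinGroup.mk_eq_mk_iff.2 ⟨Units.mk0 c hc, ?_⟩).symm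
  rw [← GeneralLinearGroup.scalar_commute]
  ext1
  simp [hg, ← smul_one_eq_diagonal]

end PadicSphere

theorem theorem2p4 (p : ℕ) [Fact p.Prime] (n : ℕ) (S : Subsemigroup (GL (Fin n) ℚ_[p]))
    (hS : (S : Set (GL (Fin n) ℚ_[p])).Nonempty) :
    List.TFAE [
      ActsDistally (PadicSphere.UnitSphere p n) (S : Set (GL (Fin n) ℚ_[p])),
      ActsDistally (PadicSphere.UnitSphere p n)
        (Subgroup.closure (S : Set (GL (Fin n) ℚ_[p])) : Set (GL (Fin n) ℚ_[p])),
      ∃ K : Subgroup (Matrix.ProjGenLinGroup (Fin n) ℚ_[p]),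
        (K : Set (Matrix.ProjGenLinGroup (Fin n) ℚ_[p])) =
            closure (Matrix.ProjGenLinGroup.mk '' (S : Set (GL (Fin n) ℚ_[p]))) ∧
          IsCompact (K : Set (Matrix.ProjGenLinGroup (Fin n) ℚ_[p]))] := by
  tfae_have 2 → 1 := ActsDistally.mono Subgroup.subset_closure
  tfae_have 3 → 2 := by
    rintro ⟨K, hK, hKc⟩
    have hle : Subgroup.closure (S : Set (GL (Fin n) ℚ_[p])) ≤ K.comap ProjGenLinGroup.mk :=
      (Subgroup.closure_le _).2 fun T hT => by
        rw [SetLike.mem_coe, Subgroup.mem_comap, ← SetLike.mem_coe, hK]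
        exact subset_closure (Set.mem_image_of_mem _ hT)
    exact actsDistally_of_mk_mem_isCompact hKc hle
  tfae_have 1 → 3 := by
    intro h
    have hc := isCompact_closure_mk_image h
    set L := (S.map (ProjGenLinGroup.mk : GL (Fin n) ℚ_[p] →* _).toMulHom).topologicalClosure
    have hLc : IsCompact (L : Set (ProjGenLinGroup (Fin n) ℚ_[p])) := hc
    obtain ⟨a, ha⟩ := hS
    have haL : ProjGenLinGroup.mk a ∈ L := subset_closure (Set.mem_image_of_mem _ ha)
    have hinv : ∀ {b}, b ∈ L → b⁻¹ ∈ L := L.inv_mem_of_isCompact hLc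
    refine ⟨{ L with
      one_mem' := by simpa using L.mul_mem haL (hinv haL)
      inv_mem' := hinv }, rfl, hc⟩
  tfae_finish
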